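/- Let $G$ be a real reductive group, i.e. a Hausdorff topological group with a continuous open homomorphism with finite kernel $p:G\to S$, where $S\subset \mathrm{GL}(n,\mathbb R)$ is a subgroup that is the zero locus in $\mathrm{GL}(n,\mathbb R)$ of a set of real polynomials in the matrix entries and is stable under transposition (so $G$ is a finite covering of an open subgroup of the real points of a symmetric algebraic group). Let $\mathfrak g=\{X\in M_n(\mathbb R): \exp(tX)\in S \text{ for all } t\in\mathbb R\}$ be its Lie algebra, let $\mathfrak p=\{X\in\mathfrak g: X^{T}=X\}$ and let $\mathfrak a\subset\mathfrak p$ be a maximal abelian subspace. For $\alpha\in\mathfrak a^*$ let $\mathfrak g^\alpha=\{Y\in\mathfrak g: [H,Y]=\alpha(H)Y \text{ for all } H\in\mathfrak a\}$, let $\Sigma=\{\alpha\in\mathfrak a^*\setminus\{0\}: \mathfrak g^\alpha\neq 0\}$, let $\Sigma^+\subset\Sigma$ be the set of roots that are positive on a fixed open Weyl chamber, and put $$\mathfrak n=\bigoplus_{\alpha\in\Sigma^+}\mathfrak g^\alpha,\quad \rho_{\mathfrak n}(X)=\tfrac12\operatorname{tr}(\operatorname{ad}X|_{\mathfrak n})\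 (X\in\mathfrak a),\quad \mathfrak a^-=\{X\in\mathfrak a:\alpha(X)\le 0\text{ for all }\alpha\in\Sigma^+\},\quad A^-=\exp(\mathfrak a^-)\subset G .$$ For $a=\exp X\in A^-$ with $X\in\mathfrak a^-$ write $a^{2\rho_{\mathfrak n}}=e^{2\rho_{\mathfrak n}(X)}$. Let $\Gamma<G$ be a lattice, i.e. a discrete subgroup such that $Y=G/\Gamma$ carries a nonzero finite $G$-invariant Borel measure; let $\operatorname{vol}_Y$ be such a measure and let $y_0=\Gamma\in Y$ be the base point. Let $B$ be a neighbourhood of $\mathbf 1$ in $G$ and let $\mathbf v_Y(y)=\operatorname{vol}_Y(By)$, $y\in Y$, be the associated volume weight (where $\operatorname{vol}_Y$ of an arbitrary subset means its outer measure). Then for every compact subset $\Omega\subset G$ there exists a constant $C>0$ such that $$\inf_{g\in\Omega}\mathbf v_Y(ag\cdot y_0)\ \ge\ C\,a^{2\rho_{\mathfrak n}}\qquad\text{for all } a\in A^- .$$ -/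

import Mathlib

open Filter Topology MeasureTheory

/-- Lie product formula in a Banach algebra (used to see that the Lie algebra of a closed linear
group is a vector space). -/
theorem tendsto_exp_mul_exp_pow {𝔸 : Type*} [NormedRing 𝔸] [NormedAlgebra ℝ 𝔸]
    [CompleteSpace 𝔸] (X Y : 𝔸) :
    Tendsto (fun k : ℕ => (NormedSpace.exp (((k : ℝ) + 1)⁻¹ • X) *
      NormedSpace.exp (((k : ℝ) + 1)⁻¹ • Y)) ^ (k + 1)) atTop
      (𝓝 (NormedSpace.exp (X + Y))) := by
  let _ : NormedAlgebra ℚ 𝔸 := NormedAlgebra.restrictScalars ℚ ℝ 𝔸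
  have h0 : HasStrictFDerivAt (NormedSpace.exp : 𝔸 → 𝔸)
      ((ContinuousLinearEquiv.refl ℝ 𝔸 : 𝔸 ≃L[ℝ] 𝔸) : 𝔸 →L[ℝ] 𝔸) 0 :=
    hasStrictFDerivAt_exp_zero_of_radius_pos (𝕂 := ℝ) (NormedSpace.expSeries_radius_pos ℝ 𝔸)
  have hL := h0.to_localInverse
  have hr := h0.eventually_right_inverse
  have hL0 := h0.localInverse_apply_image
  set L := h0.localInverse with hLdef
  rw [NormedSpace.exp_zero] at hL hr hL0
  let F : ℝ → 𝔸 := fun t => NormedSpace.exp (t • X) * NormedSpace.exp (t • Y)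
  have hF : HasDerivAt F (X + Y) 0 := by
    have h1 := hasDerivAt_exp_smul_const (𝕂 := ℝ) X 0
    have h2 := hasDerivAt_exp_smul_const (𝕂 := ℝ) Y 0
    convert! h1.mul h2 using 1
    simp only [zero_smul, NormedSpace.exp_zero, one_mul, mul_one]
  have hF0 : F 0 = 1 := by simp only [F, zero_smul, NormedSpace.exp_zero, mul_one]
  have hZ : HasDerivAt (fun t => L (F t)) (X + Y) 0 := by
    have hL' : HasFDerivAt L
        (((ContinuousLinearEquiv.refl ℝ 𝔸).symm : 𝔸 ≃L[ℝ] 𝔸) : 𝔸 →L[ℝ] 𝔸) (F 0) := by rw [hF0]; exact hL.hasFDerivAt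
    have := hL'.comp_hasDerivAt (0 : ℝ) hF
    exact this
  have ht : Tendsto (fun k : ℕ => ((k : ℝ) + 1)⁻¹) atTop (𝓝[≠] 0) := by
    refine tendsto_nhdsWithin_iff.2 ⟨?_, .of_forall fun k => ?_⟩
    · simpa [one_div] using tendsto_one_div_add_atTop_nhds_zero_nat (𝕜 := ℝ)
    · have : (k : ℝ) + 1 ≠ 0 := by positivity
      simpa using this
  have hs := hZ.tendsto_slope_zero.comp ht
  have hs' : Tendsto (fun k : ℕ => (k + 1) • L (F ((k : ℝ) + 1)⁻¹)) atTop (𝓝 (X + Y)) := by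
    refine hs.congr fun k => ?_
    simp only [Function.comp, zero_add, inv_inv, hF0, hL0, sub_zero]
    rw [← Nat.cast_smul_eq_nsmul ℝ]
    push_cast
    rfl
  have he := (NormedSpace.exp_continuous (𝔸 := 𝔸)).continuousAt.tendsto.comp hs'
  refine he.congr' ?_
  have hFc : Tendsto (fun k : ℕ => F ((k : ℝ) + 1)⁻¹) atTop (𝓝 1) := by
    have := hF.continuousAt.tendsto
    rw [hF0] at this
    exact this.comp (tendsto_nhdsWithin_iff.1 ht).1
  filter_upwards [hFc.eventually hr] with k hk
  simp only [Function.comp]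
  rw [NormedSpace.exp_nsmul]
  have : NormedSpace.exp (L (F ((k : ℝ) + 1)⁻¹)) = F ((k : ℝ) + 1)⁻¹ := hk
  rw [this]

section
open scoped Matrix.Norms.Operator

/-- The Lie product formula for real square matrices. -/
theorem Matrix.tendsto_exp_mul_exp_pow {n : ℕ} (X Y : Matrix (Fin n) (Fin n) ℝ) :
    Tendsto (fun k : ℕ => (NormedSpace.exp (((k : ℝ) + 1)⁻¹ • X) *
      NormedSpace.exp (((k : ℝ) + 1)⁻¹ • Y)) ^ (k + 1)) atTop
      (𝓝 (NormedSpace.exp (X + Y))) :=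
  _root_.tendsto_exp_mul_exp_pow X Y

end

/-- A realization of the topological group `G` as a real reductive (Lie) group: a finite covering
`proj` of an open subgroup of the real points `ambient` of a symmetric algebraic group, that is,
of a subgroup of `GL(n, ℝ)` which is cut out by real polynomials in the matrix entries and is
stable under transposition. A continuous open homomorphism with finite kernel has an open
subgroup as its image and is, for Hausdorff `G`, a covering of this image. -/
structure RealReductiveGroup (G : Type*) [Group G] [TopologicalSpace G] where
  /-- size of the matrices -/
  n : ℕ
  /-- the symmetric real algebraic group -/
  ambient : Subgroup (GL (Fin n) ℝ)
  /-- `ambient` is the zero locus in `GL(n, ℝ)` of a set of polynomials -/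
  algebraic : ∃ I : Set (MvPolynomial (Fin n × Fin n) ℝ), ∀ g : GL (Fin n) ℝ,
    g ∈ ambient ↔ ∀ f ∈ I, MvPolynomial.eval (fun ij => (g : Matrix _ _ ℝ) ij.1 ij.2) f = 0
  /-- `ambient` is stable under transposition -/
  symmetric : ∀ g ∈ ambient, ∃ h ∈ ambient,
    (h : Matrix (Fin n) (Fin n) ℝ) = (g : Matrix (Fin n) (Fin n) ℝ).transpose
  /-- the finite covering -/
  proj : G →* ambient
  continuous_proj : Continuous proj
  isOpenMap_proj : IsOpenMap proj
  finite_ker : Finite proj.ker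

namespace RealReductiveGroup

variable {G : Type*} [Group G] [TopologicalSpace G] (R : RealReductiveGroup G)

/-- The matrix algebra in which `G` is realized up to a finite covering. -/
abbrev Mat : Type := Matrix (Fin R.n) (Fin R.n) ℝ

/-- The matrix of a group element. -/
def toMat (g : G) : R.Mat := ((R.proj g : GL (Fin R.n) ℝ) : R.Mat)

theorem exp_add_mem {X Y : R.Mat}
    (hX : ∀ t : ℝ, ∃ g ∈ R.ambient, (g : R.Mat) = NormedSpace.exp (t • X))
    (hY : ∀ t : ℝ, ∃ g ∈ R.ambient, (g : R.Mat) = NormedSpace.exp (t • Y)) (t : ℝ) :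
    ∃ g ∈ R.ambient, (g : R.Mat) = NormedSpace.exp (t • (X + Y)) := by
  obtain ⟨I, hI⟩ := R.algebraic
  obtain ⟨u, hu⟩ := Matrix.isUnit_exp (t • (X + Y))
  refine ⟨u, (hI u).2 fun f hf => ?_, hu⟩
  rw [hu]
  have hc : Continuous fun M : R.Mat => MvPolynomial.eval (fun ij => M ij.1 ij.2) f := by
    refine (MvPolynomial.continuous_eval f).comp (continuous_pi fun ij => ?_)
    exact continuous_id.matrix_elem ij.1 ij.2
  have hlim := hc.continuousAt.tendsto.comp (Matrix.tendsto_exp_mul_exp_pow (t • X) (t • Y))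
  rw [← smul_add] at hlim
  refine tendsto_nhds_unique (hlim.congr fun k => ?_) (tendsto_const_nhds (x := (0 : ℝ)))
  obtain ⟨g, hg, hg'⟩ := hX (((k : ℝ) + 1)⁻¹ * t)
  obtain ⟨h, hh, hh'⟩ := hY (((k : ℝ) + 1)⁻¹ * t)
  have := (hI ((g * h) ^ (k + 1))).1 (pow_mem (mul_mem hg hh) _) f hf
  simp only [Function.comp, smul_smul]
  rw [← hg', ← hh']
  simpa using this

/-- The Lie algebra `𝔤` of `G`, realized as the space of all matrices `X` such that the
one-parameter group generated by `X` is contained in `ambient`. -/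
def lieAlg : Submodule ℝ R.Mat where
  carrier := {X | ∀ t : ℝ, ∃ g ∈ R.ambient, (g : R.Mat) = NormedSpace.exp (t • X)}
  zero_mem' := fun t => ⟨1, one_mem _, by simp [NormedSpace.exp_zero]⟩
  add_mem' := fun hX hY => R.exp_add_mem hX hY
  smul_mem' := fun c X hX t => by
    obtain ⟨g, hg, h⟩ := hX (t * c)
    exact ⟨g, hg, by rw [h, smul_smul]⟩

/-- The noncompact part `𝔭` of the Cartan decomposition of `𝔤` with respect to the Cartan
involution `X ↦ -Xᵀ`. -/
def pSpace : Submodule ℝ R.Mat where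
  carrier := {X | X ∈ R.lieAlg ∧ X.transpose = X}
  zero_mem' := ⟨zero_mem _, Matrix.transpose_zero⟩
  add_mem' := fun hX hY => ⟨add_mem hX.1 hY.1, by rw [Matrix.transpose_add, hX.2, hY.2]⟩
  smul_mem' := fun c X hX =>
    ⟨Submodule.smul_mem _ c hX.1, by rw [Matrix.transpose_smul, hX.2]⟩

/-- `ad X : Y ↦ [X, Y] = X Y - Y X`. -/
def ad (X : R.Mat) : R.Mat →ₗ[ℝ] R.Mat := LinearMap.mulLeft ℝ X - LinearMap.mulRight ℝ X

/-- `𝔞` is a maximal abelian subspace of `𝔭`. -/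
def IsMaximalAbelian (𝔞 : Submodule ℝ R.Mat) : Prop :=
  Maximal (fun 𝔟 : Submodule ℝ R.Mat => 𝔟 ≤ R.pSpace ∧ ∀ X ∈ 𝔟, ∀ Y ∈ 𝔟, R.ad X Y = 0) 𝔞

variable (𝔞 : Submodule ℝ R.Mat)

/-- The simultaneous eigenspace `𝔤^α = {Y ∈ 𝔤 | [H, Y] = α(H) Y for all H ∈ 𝔞}`. -/
def rootSpace (α : Module.Dual ℝ 𝔞) : Submodule ℝ R.Mat where
  carrier := {Y | Y ∈ R.lieAlg ∧ ∀ H : 𝔞, R.ad (H : R.Mat) Y = α H • Y}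
  zero_mem' := ⟨zero_mem _, fun H => by simp⟩
  add_mem' := fun hX hY => ⟨add_mem hX.1 hY.1, fun H => by rw [map_add, hX.2, hY.2, smul_add]⟩
  smul_mem' := fun c X hX =>
    ⟨Submodule.smul_mem _ c hX.1, fun H => by rw [map_smul, hX.2, smul_comm]⟩

/-- The (restricted) roots `Σ = Σ(𝔞, 𝔤)`. -/
def roots : Set (Module.Dual ℝ 𝔞) := {α | α ≠ 0 ∧ R.rootSpace 𝔞 α ≠ ⊥}

/-- `X₀ ∈ 𝔞` is regular, i.e. it lies in an open Weyl chamber. -/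
def IsRegular (X₀ : 𝔞) : Prop := ∀ α ∈ R.roots 𝔞, α X₀ ≠ 0

/-- The positive system `Σ⁺` belonging to the Weyl chamber of the regular element `X₀`. -/
def posRoots (X₀ : 𝔞) : Set (Module.Dual ℝ 𝔞) := {α | α ∈ R.roots 𝔞 ∧ 0 < α X₀}

/-- The closed negative Weyl chamber `𝔞⁻`. -/
def negChamber (X₀ : 𝔞) : Set 𝔞 := {X | ∀ α ∈ R.posRoots 𝔞 X₀, α X ≤ 0}

/-- `𝔫`, the sum of the root spaces of the positive roots. -/
def nSpace (X₀ : 𝔞) : Submodule ℝ R.Mat := ⨆ α ∈ R.posRoots 𝔞 X₀, R.rootSpace 𝔞 α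

theorem ad_mem_nSpace (X₀ X : 𝔞) :
    ∀ Y ∈ R.nSpace 𝔞 X₀, R.ad (X : R.Mat) Y ∈ R.nSpace 𝔞 X₀ := by
  have : R.nSpace 𝔞 X₀ ≤ (R.nSpace 𝔞 X₀).comap (R.ad (X : R.Mat)) := by
    refine iSup₂_le fun α hα Y hY => ?_
    rw [Submodule.mem_comap, hY.2 X]
    exact Submodule.smul_mem _ _ (Submodule.mem_iSup_of_mem α (Submodule.mem_iSup_of_mem hα hY))
  exact this

/-- `ρ_𝔫(X) = ½ tr (ad X |_𝔫)` for `X ∈ 𝔞`. -/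
noncomputable def rhoN (X₀ X : 𝔞) : ℝ :=
  (1 / 2 : ℝ) * LinearMap.trace ℝ (R.nSpace 𝔞 X₀)
    ((R.ad (X : R.Mat)).restrict (R.ad_mem_nSpace 𝔞 X₀ X))

/-- `a = exp X` in `G`: there is a one-parameter subgroup of `G` which is generated by `X ∈ 𝔤`
and has the value `a` at time `1`. -/
def IsExp (X : R.Mat) (a : G) : Prop :=
  ∃ φ : Multiplicative ℝ →* G, Continuous φ ∧
    (∀ t : ℝ, R.toMat (φ (Multiplicative.ofAdd t)) = NormedSpace.exp (t • X)) ∧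
    φ (Multiplicative.ofAdd 1) = a

end RealReductiveGroup

/-- `Γ` is a lattice: it is discrete, and `G / Γ` carries a nonzero finite `G`-invariant Borel
measure. -/
def IsLatticeSubgroup {G : Type*} [Group G] [TopologicalSpace G] (Γ : Subgroup G)
    [MeasurableSpace (G ⧸ Γ)] [BorelSpace (G ⧸ Γ)] : Prop :=
  DiscreteTopology Γ ∧
    ∃ μ : Measure (G ⧸ Γ), μ ≠ 0 ∧ IsFiniteMeasure μ ∧ SMulInvariantMeasure G (G ⧸ Γ) μ

/-- The volume weight `v(y) = vol(B y)` attached to a set `B ⊆ G` (a neighbourhood of `1`). -/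
noncomputable def volumeWeight {G Y : Type*} [SMul G Y] [MeasurableSpace Y] (vol : Measure Y)
    (B : Set G) (y : Y) : ENNReal :=
  vol ((fun b => b • y) '' B)

section ClosedSubgroup

variable {𝔸 : Type*} [NormedRing 𝔸] [NormedAlgebra ℝ 𝔸] [CompleteSpace 𝔸]

theorem hasStrictFDerivAt_exp_zero_real :
    HasStrictFDerivAt (NormedSpace.exp : 𝔸 → 𝔸) (1 : 𝔸 →L[ℝ] 𝔸) 0 :=
  hasStrictFDerivAt_exp_zero_of_radius_pos (𝕂 := ℝ) (NormedSpace.expSeries_radius_pos ℝ 𝔸)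

theorem continuous_exp_real : Continuous (NormedSpace.exp : 𝔸 → 𝔸) := by
  let _ : NormedAlgebra ℚ 𝔸 := NormedAlgebra.restrictScalars ℚ ℝ 𝔸
  exact NormedSpace.exp_continuous

/-- The exponential of an element, as a unit. -/
noncomputable def expUnit (x : 𝔸) : 𝔸ˣ :=
  let _ : NormedAlgebra ℚ 𝔸 := NormedAlgebra.restrictScalars ℚ ℝ 𝔸
  ⟨NormedSpace.exp x, NormedSpace.exp (-x),
    by rw [← NormedSpace.exp_add_of_commute (Commute.refl x).neg_right, add_neg_cancel,
      NormedSpace.exp_zero],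
    by rw [← NormedSpace.exp_add_of_commute (Commute.refl x).neg_left, neg_add_cancel,
      NormedSpace.exp_zero]⟩

@[simp] theorem coe_expUnit (x : 𝔸) : (expUnit x : 𝔸) = NormedSpace.exp x := rfl

theorem coe_inv_expUnit (x : 𝔸) : ((expUnit x)⁻¹ : 𝔸ˣ) = NormedSpace.exp (-x) := rfl

theorem coe_expUnit_zpow (x : 𝔸) (k : ℤ) :
    ((expUnit x ^ k : 𝔸ˣ) : 𝔸) = NormedSpace.exp ((k : ℝ) • x) := by
  let _ : NormedAlgebra ℚ 𝔸 := NormedAlgebra.restrictScalars ℚ ℝ 𝔸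
  have h (m : ℕ) (y : 𝔸) : ((expUnit y ^ m : 𝔸ˣ) : 𝔸) = NormedSpace.exp ((m : ℝ) • y) := by
    rw [Units.val_pow_eq_pow_val, coe_expUnit, ← NormedSpace.exp_nsmul, Nat.cast_smul_eq_nsmul]
  obtain ⟨m, rfl | rfl⟩ := k.eq_nat_or_neg
  · simpa using h m x
  · have h1 : (expUnit x)⁻¹ = expUnit (-x) := Units.ext rfl
    rw [zpow_neg, ← inv_zpow, h1, zpow_natCast, h]
    simp

theorem exp_smul_mem_of_tendsto_direction {β : Type*} {l : Filter β} [l.NeBot] {C : Set 𝔸}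
    (hC : IsClosed C) (S : Subgroup 𝔸ˣ) (hS : ∀ u ∈ S, (u : 𝔸) ∈ C) {y : β → 𝔸}
    (hy0 : Tendsto y l (𝓝 0)) (hyS : ∀ᶠ b in l, expUnit (y b) ∈ S) {v : 𝔸}
    (hv : Tendsto (fun b => ‖y b‖⁻¹ • y b) l (𝓝 v)) (t : ℝ) :
    NormedSpace.exp (t • v) ∈ C := by
  have hk : Tendsto (fun b => ((⌊t / ‖y b‖⌋ : ℤ) : ℝ) • y b) l (𝓝 (t • v)) := by
    have h1 : Tendsto (fun b => (((⌊t / ‖y b‖⌋ : ℤ) : ℝ) - t / ‖y b‖) • y b) l (𝓝 0) := by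
      refine squeeze_zero_norm (a := fun b => ‖y b‖) (fun b => ?_) (by simpa using hy0.norm)
      rw [norm_smul]
      refine mul_le_of_le_one_left (norm_nonneg _) ?_
      rw [Real.norm_eq_abs, abs_le]
      constructor
      · linarith [Int.lt_floor_add_one (t / ‖y b‖)]
      · linarith [Int.floor_le (t / ‖y b‖)]
    have h2 := h1.add (hv.const_smul t)
    rw [zero_add] at h2
    refine h2.congr fun b => ?_
    rw [smul_smul, ← add_smul, div_eq_mul_inv]
    congr 1
    ring
  refine hC.mem_of_tendsto ((continuous_exp_real.tendsto _).comp hk) ?_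
  filter_upwards [hyS] with b hb
  rw [Function.comp, ← coe_expUnit_zpow]
  exact hS _ (zpow_mem hb _)

/-- A closed linear group is locally the image of its Lie algebra under the exponential map. -/
theorem eventually_mem_exp_image_of_closed_subgroup [FiniteDimensional ℝ 𝔸] {C : Set 𝔸}
    (hC : IsClosed C) (S : Subgroup 𝔸ˣ) (hS : ∀ u : 𝔸ˣ, u ∈ S ↔ (u : 𝔸) ∈ C)
    (𝔥 : Submodule ℝ 𝔸) (h𝔥 : ∀ x, x ∈ 𝔥 ↔ ∀ t : ℝ, NormedSpace.exp (t • x) ∈ C)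
    {W : Set 𝔥} (hW : W ∈ 𝓝 (0 : 𝔥)) :
    ∀ᶠ M in 𝓝 (1 : 𝔸), M ∈ C → ∃ x ∈ W, M = NormedSpace.exp (x : 𝔸) := by
  obtain ⟨E, hE⟩ := 𝔥.exists_isCompl
  let e : (𝔥 × E) ≃L[ℝ] 𝔸 := (Submodule.prodEquivOfIsCompl 𝔥 E hE).toContinuousLinearEquiv
  let Φ : 𝔥 × E → 𝔸 := fun z => NormedSpace.exp (z.1 : 𝔸) * NormedSpace.exp (z.2 : 𝔸)
  have hΦ : HasStrictFDerivAt Φ (e : 𝔥 × E →L[ℝ] 𝔸) 0 := by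
    have h1 : HasStrictFDerivAt (fun z : 𝔥 × E => NormedSpace.exp (z.1 : 𝔸))
        ((1 : 𝔸 →L[ℝ] 𝔸).comp (𝔥.subtypeL.comp (ContinuousLinearMap.fst ℝ 𝔥 E))) 0 := by
      refine HasStrictFDerivAt.comp (g := NormedSpace.exp) (0 : 𝔥 × E) ?_
        (𝔥.subtypeL.comp (ContinuousLinearMap.fst ℝ 𝔥 E)).hasStrictFDerivAt
      simpa using hasStrictFDerivAt_exp_zero_real
    have h2 : HasStrictFDerivAt (fun z : 𝔥 × E => NormedSpace.exp (z.2 : 𝔸))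
        ((1 : 𝔸 →L[ℝ] 𝔸).comp (E.subtypeL.comp (ContinuousLinearMap.snd ℝ 𝔥 E))) 0 := by
      refine HasStrictFDerivAt.comp (g := NormedSpace.exp) (0 : 𝔥 × E) ?_
        (E.subtypeL.comp (ContinuousLinearMap.snd ℝ 𝔥 E)).hasStrictFDerivAt
      simpa using hasStrictFDerivAt_exp_zero_real
    refine (h1.mul' h2).congr_fderiv ?_
    ext z <;> simp [e, NormedSpace.exp_zero]
  have hΦ0 : Φ 0 = 1 := by simp [Φ, NormedSpace.exp_zero]
  have hmem (x : 𝔥) : expUnit (x : 𝔸) ∈ S := by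
    rw [hS, coe_expUnit]
    simpa using (h𝔥 x).1 x.2 1
  have hkey : ∀ᶠ z : 𝔥 × E in 𝓝 0, Φ z ∈ C → z.2 = 0 := by
    by_contra hcon
    rw [not_eventually] at hcon
    let l : Filter (𝔥 × E) := 𝓝 0 ⊓ 𝓟 {z | ¬ (Φ z ∈ C → z.2 = 0)}
    have : l.NeBot := frequently_mem_iff_neBot.1 hcon
    let u := Ultrafilter.of l
    have hul : (u : Filter (𝔥 × E)) ≤ l := Ultrafilter.of_le l
    have hP : ∀ᶠ z : 𝔥 × E in u, ¬ (Φ z ∈ C → z.2 = 0) :=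
      hul (mem_inf_of_right (mem_principal_self _))
    have hy0 : Tendsto (fun z : 𝔥 × E => (z.2 : 𝔸)) u (𝓝 0) := by
      have : Continuous fun z : 𝔥 × E => (z.2 : 𝔸) := by fun_prop
      have h := this.tendsto 0
      simp only [Prod.snd_zero, ZeroMemClass.coe_zero] at h
      exact h.mono_left (hul.trans inf_le_left)
    have hne : ∀ᶠ z : 𝔥 × E in u, (z.2 : 𝔸) ≠ 0 := by
      filter_upwards [hP] with z hz h
      exact hz fun _ => Subtype.ext h
    have hyS : ∀ᶠ z : 𝔥 × E in u, expUnit (z.2 : 𝔸) ∈ S := by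
      filter_upwards [hP] with z hz
      have hz' : Φ z ∈ C := by tauto
      have : expUnit (z.1 : 𝔸) * expUnit (z.2 : 𝔸) ∈ S := (hS _).2 hz'
      exact (Subgroup.mul_mem_cancel_left _ (hmem z.1)).1 this
    have : FiniteDimensional ℝ E := inferInstance
    have : ProperSpace E := FiniteDimensional.proper ℝ E
    have hsph : (Filter.map (fun z : 𝔥 × E => ‖z.2‖⁻¹ • z.2) (u : Filter (𝔥 × E)))
        ≤ 𝓟 (Metric.sphere (0 : E) 1) := by
      rw [le_principal_iff, mem_map]
      filter_upwards [hne] with z hz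
      have h0 : ‖z.2‖ ≠ 0 := by simpa using hz
      rw [Set.mem_preimage, mem_sphere_zero_iff_norm, norm_smul, norm_inv, norm_norm,
        inv_mul_cancel₀ h0]
    obtain ⟨v, hv, hlim⟩ := (isCompact_sphere (0 : E) 1).ultrafilter_le_nhds
      (u.map fun z : 𝔥 × E => ‖z.2‖⁻¹ • z.2) hsph
    have hlim' : Tendsto (fun z : 𝔥 × E => ‖(z.2 : 𝔸)‖⁻¹ • (z.2 : 𝔸)) u (𝓝 (v : 𝔸)) :=
      (continuous_subtype_val.tendsto v).comp hlim
    have hvh : (v : 𝔸) ∈ 𝔥 := (h𝔥 _).2 fun t =>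
      exp_smul_mem_of_tendsto_direction hC S (fun w hw => (hS w).1 hw) hy0 hyS hlim' t
    have hv0 : (v : 𝔸) = 0 := by
      have := hE.disjoint.le_bot (Submodule.mem_inf.2 ⟨hvh, v.2⟩)
      simpa using this
    have : v = 0 := Subtype.ext hv0
    simp [this] at hv
  have hmap := hΦ.map_nhds_eq_of_equiv
  rw [hΦ0] at hmap
  rw [← hmap, eventually_map]
  have hW' : ∀ᶠ z : 𝔥 × E in 𝓝 0, z.1 ∈ W := (continuous_fst.tendsto (0 : 𝔥 × E)) hW
  filter_upwards [hkey, hW'] with z hz hzW hzC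
  refine ⟨z.1, hzW, ?_⟩
  simp [Φ, hz hzC, NormedSpace.exp_zero]

end ClosedSubgroup

section Packing

variable {𝔸 : Type*} [NormedRing 𝔸] [NormedAlgebra ℝ 𝔸] [CompleteSpace 𝔸]

/-- In exponential coordinates on a finite dimensional subspace the exponential map is
bi-Lipschitz near the origin. -/
theorem exists_exp_comp_biLipschitzOn {V : Type*} [NormedAddCommGroup V] [NormedSpace ℝ V]
    [FiniteDimensional ℝ V] (L : V →ₗ[ℝ] 𝔸) (hL : Function.Injective L) :
    ∃ r > 0, ∃ K K' : NNReal,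
      LipschitzOnWith K (fun t => NormedSpace.exp (L t)) (Metric.closedBall 0 r) ∧
      ∀ s ∈ Metric.closedBall (0 : V) r, ∀ t ∈ Metric.closedBall (0 : V) r,
        dist s t ≤ K' * dist (NormedSpace.exp (L s)) (NormedSpace.exp (L t)) := by
  let L' : V →L[ℝ] 𝔸 := LinearMap.toContinuousLinearMap L
  have hd : HasStrictFDerivAt (fun t => NormedSpace.exp (L t)) L' 0 := by
    have := HasStrictFDerivAt.comp (g := NormedSpace.exp) (f := L') (0 : V)
      (by simpa using hasStrictFDerivAt_exp_zero_real) L'.hasStrictFDerivAt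
    exact this
  obtain ⟨c, hc0, hc⟩ := L.exists_antilipschitzWith (LinearMap.ker_eq_bot.2 hL)
  obtain ⟨K, hK⟩ := hd.exists_lipschitzOnWith
  have hε : (0 : ℝ) < 1 / (2 * c) := by positivity
  have h1 := hd.isLittleO.def hε
  obtain ⟨U, hU, hKU⟩ := hK
  rw [nhds_prod_eq] at h1
  obtain ⟨U', hU', hUU⟩ := eventually_prod_self_iff'.1 h1
  obtain ⟨r, hr, hrU⟩ := Metric.nhds_basis_closedBall.mem_iff.1 (inter_mem hU hU')
  refine ⟨r, hr, K, 2 * c, hKU.mono fun x hx => (hrU hx).1, fun s hs t ht => ?_⟩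
  have h2 := hUU _ (hrU hs).2 _ (hrU ht).2
  have h3 := hc.le_mul_dist s t
  simp only [dist_eq_norm, NNReal.coe_mul, NNReal.coe_ofNat] at *
  have h4 : ‖L s - L t‖ ≤ ‖NormedSpace.exp (L s) - NormedSpace.exp (L t)‖ +
      1 / (2 * c) * ‖s - t‖ := by
    have h5 := norm_sub_norm_le (L s - L t) (NormedSpace.exp (L s) - NormedSpace.exp (L t))
    rw [norm_sub_rev (L s - L t)] at h5
    have : L' (s - t) = L s - L t := map_sub L s t
    rw [this] at h2
    linarith
  have hc0' : (0 : ℝ) < c := hc0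
  have h6 : (c : ℝ) * (1 / (2 * c) * ‖s - t‖) = ‖s - t‖ / 2 := by field_simp
  nlinarith [mul_le_mul_of_nonneg_left h4 hc0'.le]

/-- Volume bound for packings: the number of disjoint translates of the exponential image of a box
is bounded by a constant over the volume of the box. -/
theorem exists_packing_bound {ι κ : Type*} [Fintype ι] (u : κ → 𝔸ˣ) (L : (ι → ℝ) →ₗ[ℝ] 𝔸)
    (hL : Function.Injective L) (Q : NNReal) :
    ∃ r > 0, ∃ C > (0 : ℝ), ∀ η : ι → ℝ, (∀ i, 0 ≤ η i) → (∀ i, η i ≤ r) → ∀ s : Finset κ,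
      (∀ k ∈ s, ‖(((u k)⁻¹ : 𝔸ˣ) : 𝔸)‖ ≤ Q) →
      ((s : Set κ).PairwiseDisjoint fun k =>
        (fun t => (u k : 𝔸) * NormedSpace.exp (L t)) '' Set.Icc (-η) η) →
      (∀ k ∈ s, ∀ t ∈ Set.Icc (-η) η, ∃ t' ∈ Metric.closedBall (0 : ι → ℝ) r,
        (u k : 𝔸) * NormedSpace.exp (L t) = NormedSpace.exp (L t')) →
      s.card * ∏ i, η i ≤ C := by
  obtain ⟨r, hr, K, K', hK, hK'⟩ := exists_exp_comp_biLipschitzOn L hL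
  let _ : MeasurableSpace 𝔸 := borel 𝔸
  have : BorelSpace 𝔸 := ⟨rfl⟩
  let d : ℝ := Fintype.card ι
  have hd : 0 ≤ d := Nat.cast_nonneg _
  let F : (ι → ℝ) → 𝔸 := fun t => NormedSpace.exp (L t)
  have hFc : Continuous F := continuous_exp_real.comp L.continuous_of_finiteDimensional
  have hvol : (Measure.hausdorffMeasure d : Measure (ι → ℝ)) = volume := hausdorffMeasure_pi_real
  let M : ENNReal := ((K' * Q : NNReal) : ENNReal) ^ d *
    ((K : ENNReal) ^ d * volume (Metric.closedBall (0 : ι → ℝ) r))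
  have hM : M ≠ ⊤ := by
    refine ENNReal.mul_ne_top (ENNReal.rpow_ne_top_of_nonneg hd ENNReal.coe_ne_top)
      (ENNReal.mul_ne_top (ENNReal.rpow_ne_top_of_nonneg hd ENNReal.coe_ne_top) ?_)
    exact (isCompact_closedBall _ _).measure_lt_top.ne
  refine ⟨r, hr, M.toReal + 1, by positivity, fun η hη0 hηr s hs hdisj hsub => ?_⟩
  have hbox : Set.Icc (-η) η ⊆ Metric.closedBall (0 : ι → ℝ) r := by
    intro t ht
    rw [mem_closedBall_zero_iff, pi_norm_le_iff_of_nonneg hr.le]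
    intro i
    rw [Real.norm_eq_abs, abs_le]
    have h1 := ht.1 i
    have h2 := ht.2 i
    have h3 := hηr i
    simp only [Pi.neg_apply] at h1
    constructor <;> linarith
  let Eu : κ → Set 𝔸 := fun k => (fun t => (u k : 𝔸) * F t) '' Set.Icc (-η) η
  have hEm (k : κ) : MeasurableSet (Eu k) := by
    have : IsCompact (Eu k) := isCompact_Icc.image (by fun_prop)
    exact this.isClosed.measurableSet
  have hlow : ∀ k ∈ s, volume (Set.Icc (-η) η) ≤
      ((K' * Q : NNReal) : ENNReal) ^ d * Measure.hausdorffMeasure d (Eu k) := by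
    intro k hk
    let g : 𝔸 → (ι → ℝ) := fun x =>
      Function.invFunOn F (Metric.closedBall 0 r) ((((u k)⁻¹ : 𝔸ˣ) : 𝔸) * x)
    have hinj : Set.InjOn F (Metric.closedBall 0 r) := by
      intro x hx y hy hxy
      have := hK' x hx y hy
      change dist x y ≤ K' * dist (F x) (F y) at this
      rw [hxy, dist_self, mul_zero] at this
      exact dist_le_zero.1 this
    have hg : ∀ t ∈ Set.Icc (-η) η, g (u k * F t) = t := by
      intro t ht
      change Function.invFunOn F (Metric.closedBall 0 r) ((((u k)⁻¹ : 𝔸ˣ) : 𝔸) * (u k * F t)) = t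
      rw [Units.inv_mul_cancel_left]
      exact hinj.leftInvOn_invFunOn (hbox ht)
    have himg : g '' Eu k = Set.Icc (-η) η := by
      rw [Set.image_image]
      exact (Set.image_congr hg).trans (Set.image_id' _)
    have hlip : LipschitzOnWith (K' * Q) g (Eu k) := by
      refine LipschitzOnWith.of_dist_le_mul ?_
      rintro _ ⟨x, hx, rfl⟩ _ ⟨y, hy, rfl⟩
      change dist (g (u k * F x)) (g (u k * F y)) ≤ (K' * Q : NNReal) * dist (u k * F x) (u k * F y)
      rw [hg x hx, hg y hy]
      refine (hK' x (hbox hx) y (hbox hy)).trans ?_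
      rw [NNReal.coe_mul, mul_assoc]
      refine mul_le_mul_of_nonneg_left ?_ K'.2
      rw [dist_eq_norm, dist_eq_norm, ← mul_sub]
      calc ‖F x - F y‖ = ‖(((u k)⁻¹ : 𝔸ˣ) : 𝔸) * (u k * (F x - F y))‖ := by
            rw [Units.inv_mul_cancel_left]
        _ ≤ _ := (norm_mul_le _ _).trans (mul_le_mul_of_nonneg_right (hs k hk) (norm_nonneg _))
    have := hlip.hausdorffMeasure_image_le hd
    rwa [himg, hvol] at this
  have hup : ∑ k ∈ s, Measure.hausdorffMeasure d (Eu k) ≤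
      (K : ENNReal) ^ d * volume (Metric.closedBall (0 : ι → ℝ) r) := by
    rw [← measure_biUnion_finset hdisj fun k _ => hEm k]
    have h1 := hK.hausdorffMeasure_image_le hd
    rw [hvol] at h1
    refine (measure_mono ?_).trans h1
    refine Set.iUnion₂_subset fun k hk => ?_
    rintro _ ⟨t, ht, rfl⟩
    obtain ⟨t', ht', h⟩ := hsub k hk t ht
    exact ⟨t', ht', h.symm⟩
  have hfin : (s.card : ENNReal) * volume (Set.Icc (-η) η) ≤ M := by
    rw [← nsmul_eq_mul]
    refine (Finset.card_nsmul_le_sum s _ _ hlow).trans ?_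
    rw [← Finset.mul_sum]
    exact mul_le_mul_right hup _
  rw [Real.volume_Icc_pi, ← ENNReal.ofReal_prod_of_nonneg
    (fun i _ => by simpa using add_nonneg (hη0 i) (hη0 i))] at hfin
  have h2 := ENNReal.toReal_mono hM hfin
  have h0 : 0 ≤ ∏ i, (η i - (-η) i) :=
    Finset.prod_nonneg fun i _ => by simpa using add_nonneg (hη0 i) (hη0 i)
  rw [ENNReal.toReal_mul, ENNReal.toReal_natCast, ENNReal.toReal_ofReal h0] at h2
  have h3 : ∏ i, η i ≤ ∏ i, (η i - (-η) i) := by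
    refine Finset.prod_le_prod (fun i _ => hη0 i) fun i _ => ?_
    simpa using hη0 i
  have := mul_le_mul_of_nonneg_left h3 (Nat.cast_nonneg (α := ℝ) s.card)
  linarith

open Pointwise in
/-- A maximal packing by translates of `D` gives a covering by translates of `D * D⁻¹`. -/
theorem exists_covering_of_packing_bound {G : Type*} [Group G] (K D : Set G) (hD : D.Nonempty)
    (N : ℕ) (hN : ∀ s : Finset G, (s : Set G) ⊆ K →
      ((s : Set G).PairwiseDisjoint fun k => k • D) → s.card ≤ N) :
    ∃ s : Finset G, (s : Set G) ⊆ K ∧ ((s : Set G).PairwiseDisjoint fun k => k • D) ∧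
      K ⊆ ⋃ k ∈ s, k • (D * D⁻¹) := by
  classical
  let P : ℕ → Prop := fun m => ∃ s : Finset G, (s : Set G) ⊆ K ∧
    ((s : Set G).PairwiseDisjoint fun k => k • D) ∧ s.card = m
  have hP0 : P 0 := ⟨∅, by simp, by simp, rfl⟩
  obtain ⟨s, hsK, hsd, hsc⟩ := Nat.findGreatest_spec (P := P) (Nat.zero_le N) hP0
  refine ⟨s, hsK, hsd, fun k hk => ?_⟩
  by_cases h : ∀ j ∈ s, Disjoint (k • D) (j • D)
  · exfalso
    have hks : k ∉ s := by
      intro hks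
      have := h k hks
      rw [disjoint_self, Set.bot_eq_empty, Set.smul_set_eq_empty] at this
      exact hD.ne_empty this
    have hPs : P (s.card + 1) := by
      refine ⟨insert k s, ?_, ?_, Finset.card_insert_of_notMem hks⟩
      · rw [Finset.coe_insert]
        exact Set.insert_subset hk hsK
      · rw [Finset.coe_insert]
        exact hsd.insert fun j hj _ => h j hj
    have hle : s.card + 1 ≤ N := by
      obtain ⟨s', h1, h2, h3⟩ := hPs
      exact h3 ▸ hN s' h1 h2
    have := Nat.le_findGreatest hle hPs
    omega
  · push Not at h
    obtain ⟨j, hj, hjD⟩ := h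
    obtain ⟨x, ⟨d, hd, rfl⟩, ⟨d', hd', hx⟩⟩ := Set.not_disjoint_iff.1 hjD
    refine Set.mem_iUnion₂.2 ⟨j, hj, d' * d⁻¹, Set.mul_mem_mul hd' (Set.inv_mem_inv.2 hd), ?_⟩
    simp only [smul_eq_mul] at hx ⊢
    rw [← mul_assoc, hx, mul_inv_cancel_right]

end Packing

section Commutator

variable {𝔸 : Type*} [NormedRing 𝔸] [NormedAlgebra ℝ 𝔸] [CompleteSpace 𝔸]

/-- A finite dimensional subspace which is stable under conjugation by a one-parameter group is
stable under commutators with its generator. -/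
theorem commutator_mem_of_exp_conj_mem (𝔥 : Submodule ℝ 𝔸) [FiniteDimensional ℝ 𝔥] (x y : 𝔸)
    (h : ∀ t : ℝ, NormedSpace.exp (t • x) * y * NormedSpace.exp (-(t • x)) ∈ 𝔥) :
    x * y - y * x ∈ 𝔥 := by
  have h1 := hasDerivAt_exp_smul_const (𝕂 := ℝ) x 0
  have h2 := hasDerivAt_exp_smul_const (𝕂 := ℝ) (-x) 0
  have h3 := (h1.mul_const y).mul h2
  simp only [zero_smul, neg_zero, NormedSpace.exp_zero, one_mul, mul_one, mul_neg, smul_neg] at h3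
  rw [← sub_eq_add_neg] at h3
  have h4 := hasDerivAt_iff_tendsto_slope.1 h3
  refine (𝔥.closed_of_finiteDimensional).mem_of_tendsto h4 (.of_forall fun t => ?_)
  rw [slope_def_module]
  exact 𝔥.smul_mem _ (𝔥.sub_mem (h t) (by simpa using h 0))

/-- If `y` is an eigenvector of `ad x`, then it is an eigenvector for the conjugation by
`exp x`. -/
theorem exp_mul_mul_exp_neg_of_commutator_eq_smul {x y : 𝔸} {c : ℝ} (h : x * y - y * x = c • y) :
    NormedSpace.exp x * y * NormedSpace.exp (-x) = Real.exp c • y := by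
  let _ : NormedAlgebra ℚ 𝔸 := NormedAlgebra.restrictScalars ℚ ℝ 𝔸
  have h1 : SemiconjBy y (x + algebraMap ℝ 𝔸 c) x := by
    rw [SemiconjBy, mul_add, ← Algebra.commutes, ← Algebra.smul_def, ← h]
    abel
  have h2 := h1.exp_right
  have hc : Commute x (algebraMap ℝ 𝔸 c) := (Algebra.commutes c x).symm
  rw [SemiconjBy, NormedSpace.exp_add_of_commute hc, ← NormedSpace.algebraMap_exp_comm,
    ← Real.exp_eq_exp_ℝ] at h2
  have h3 : NormedSpace.exp x * NormedSpace.exp (-x) = 1 := (expUnit x).mul_inv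
  rw [← h2, ← Algebra.commutes, mul_assoc, mul_assoc, h3, mul_one,
    Algebra.smul_def, Algebra.commutes]

end Commutator

/-- Commuting operators which are symmetric for an inner product are simultaneously
diagonalizable. -/
theorem iSup_iInf_eigenspace_eq_top_of_core {V ι : Type*} [AddCommGroup V] [Module ℝ V]
    [FiniteDimensional ℝ V] (c : InnerProductSpace.Core ℝ V) (T : ι → V →ₗ[ℝ] V)
    (hT : ∀ i x y, c.inner (T i x) y = c.inner x (T i y)) (hc : ∀ i j, Commute (T i) (T j)) :
    ⨆ χ : ι → ℝ, ⨅ i, Module.End.eigenspace (T i) (χ i) = ⊤ := by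
  let _ : NormedAddCommGroup V := c.toNormedAddCommGroup
  let _ : InnerProductSpace ℝ V := InnerProductSpace.ofCore c.toCore
  exact LinearMap.IsSymmetric.iSup_iInf_eq_top_of_commute (fun i => hT i) fun i j _ => hc i j

theorem LinearMap.trace_eq_sum_of_basis_eigenvectors {V ι : Type*} [AddCommGroup V] [Module ℝ V]
    [Fintype ι] (b : Module.Basis ι ℝ V) (f : V →ₗ[ℝ] V) (c : ι → ℝ)
    (h : ∀ i, f (b i) = c i • b i) : LinearMap.trace ℝ V f = ∑ i, c i := by
  classical
  rw [LinearMap.trace_eq_matrix_trace ℝ b, Matrix.trace]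
  refine Finset.sum_congr rfl fun i _ => ?_
  rw [Matrix.diag_apply, LinearMap.toMatrix_apply, h]
  simp

namespace RealReductiveGroup

variable {G : Type*} [Group G] [TopologicalSpace G] (R : RealReductiveGroup G)

theorem ad_apply (X Y : R.Mat) : R.ad X Y = X * Y - Y * X := rfl

theorem exists_closed_mem_ambient_iff :
    ∃ C : Set R.Mat, IsClosed C ∧ ∀ g : GL (Fin R.n) ℝ, g ∈ R.ambient ↔ (g : R.Mat) ∈ C := by
  obtain ⟨I, hI⟩ := R.algebraic
  refine ⟨{M | ∀ f ∈ I, MvPolynomial.eval (fun ij => M ij.1 ij.2) f = 0}, ?_, hI⟩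
  have : {M : R.Mat | ∀ f ∈ I, MvPolynomial.eval (fun ij => M ij.1 ij.2) f = 0} =
      ⋂ f ∈ I, {M | MvPolynomial.eval (fun ij => M ij.1 ij.2) f = 0} := by
    ext; simp
  rw [this]
  refine isClosed_biInter fun f _ => isClosed_eq ?_ continuous_const
  refine (MvPolynomial.continuous_eval f).comp (continuous_pi fun ij => ?_)
  exact continuous_id.matrix_elem ij.1 ij.2

theorem transpose_mem_lieAlg {X : R.Mat} (hX : X ∈ R.lieAlg) : X.transpose ∈ R.lieAlg := by
  intro t
  obtain ⟨g, hg, h⟩ := hX t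
  obtain ⟨g', hg', h'⟩ := R.symmetric g hg
  refine ⟨g', hg', ?_⟩
  rw [h', h, ← Matrix.transpose_smul, Matrix.exp_transpose]

section
open scoped Matrix.Norms.Operator

theorem ad_mem_lieAlg {X Y : R.Mat} (hX : X ∈ R.lieAlg) (hY : Y ∈ R.lieAlg) :
    R.ad X Y ∈ R.lieAlg := by
  refine commutator_mem_of_exp_conj_mem R.lieAlg X Y fun t s => ?_
  obtain ⟨g, hg, h⟩ := hX t
  obtain ⟨k, hk, h'⟩ := hY s
  have hinv : ((g⁻¹ : GL (Fin R.n) ℝ) : R.Mat) = NormedSpace.exp (-(t • X)) := by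
    have : g = expUnit (t • X) := Units.ext h
    rw [this, coe_inv_expUnit]
    rfl
  refine ⟨g * k * g⁻¹, mul_mem (mul_mem hg hk) (inv_mem hg), ?_⟩
  have h1 := Matrix.exp_units_conj g (s • Y)
  rw [← h', mul_smul_comm, smul_mul_assoc, hinv, h] at h1
  rw [Units.val_mul, Units.val_mul, hinv, h]
  exact h1.symm
end

/-- The trace form `tr(Xᵀ Y)` on the Lie algebra. -/
noncomputable abbrev traceCore : InnerProductSpace.Core ℝ R.lieAlg where
  inner X Y := ((X : R.Mat).transpose * (Y : R.Mat)).trace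
  conj_inner_symm X Y := by
    rw [← Matrix.trace_transpose]
    simp
  re_inner_nonneg X := by
    simp only [RCLike.re_to_real, Matrix.trace, Matrix.diag_apply, Matrix.mul_apply,
      Matrix.transpose_apply]
    exact Finset.sum_nonneg fun i _ => Finset.sum_nonneg fun j _ => mul_self_nonneg _
  add_left X Y Z := by simp [add_mul]
  smul_left X Y r := by simp
  definite X h := by
    have := Matrix.trace_conjTranspose_mul_self_eq_zero_iff (A := (X : R.Mat))
    rw [Matrix.conjTranspose_eq_transpose_of_trivial] at this
    exact Subtype.ext (this.1 h)

variable (𝔞 : Submodule ℝ R.Mat)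

/-- `ad H` as an operator on the Lie algebra. -/
noncomputable def adLie {H : R.Mat} (hH : H ∈ R.lieAlg) : R.lieAlg →ₗ[ℝ] R.lieAlg :=
  (R.ad H).restrict fun _ hY => R.ad_mem_lieAlg hH hY

theorem coe_adLie {H : R.Mat} (hH : H ∈ R.lieAlg) (Y : R.lieAlg) :
    (R.adLie hH Y : R.Mat) = H * Y - Y * H := rfl

variable {𝔞}

theorem span_rootSpaces (hp : 𝔞 ≤ R.pSpace) (hc : ∀ X ∈ 𝔞, ∀ Y ∈ 𝔞, R.ad X Y = 0) :
    Submodule.span ℝ {Y : R.lieAlg | ∃ α, (Y : R.Mat) ∈ R.rootSpace 𝔞 α} = ⊤ := by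
  let T : 𝔞 → R.lieAlg →ₗ[ℝ] R.lieAlg := fun H => R.adLie (hp H.2).1
  have hT : ∀ H x y, R.traceCore.inner (T H x) y = R.traceCore.inner x (T H y) := by
    intro H x y
    change ((R.adLie _ x : R.Mat).transpose * (y : R.Mat)).trace =
      ((x : R.Mat).transpose * (R.adLie _ y : R.Mat)).trace
    have hH : (H : R.Mat).transpose = H := (hp H.2).2
    rw [coe_adLie, coe_adLie, Matrix.transpose_sub, Matrix.transpose_mul, Matrix.transpose_mul, hH,
      sub_mul, mul_sub, Matrix.trace_sub, Matrix.trace_sub, mul_assoc]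
    congr 1
    rw [mul_assoc, Matrix.trace_mul_comm, mul_assoc]
  have hcomm : ∀ H H', Commute (T H) (T H') := by
    intro H H'
    have h0 : (H : R.Mat) * H' - H' * H = 0 := hc H H.2 H' H'.2
    rw [sub_eq_zero] at h0
    refine LinearMap.ext fun Y => Subtype.ext ?_
    change (H : R.Mat) * (H' * Y - Y * H') - (H' * Y - Y * H') * H =
      H' * (H * Y - Y * H) - (H * Y - Y * H) * H'
    have h1 : (H : R.Mat) * (H' * Y) = H' * (H * Y) := by rw [← mul_assoc, h0, mul_assoc]
    have h2 : (Y : R.Mat) * H' * H = Y * H * H' := by rw [mul_assoc, ← h0, mul_assoc]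
    rw [mul_sub, sub_mul, mul_sub, sub_mul, h1, h2]
    simp only [mul_assoc]
    abel
  rw [eq_top_iff, ← iSup_iInf_eigenspace_eq_top_of_core R.traceCore T hT hcomm]
  refine iSup_le fun χ Y hY => ?_
  by_cases hY0 : Y = 0
  · rw [hY0]; exact zero_mem _
  have hY' (H : 𝔞) : R.ad (H : R.Mat) Y = χ H • (Y : R.Mat) :=
    congrArg Subtype.val (Module.End.mem_eigenspace_iff.1 ((Submodule.mem_iInf _).1 hY H))
  have hne : (Y : R.Mat) ≠ 0 := fun h => hY0 (Subtype.ext h)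
  refine Submodule.subset_span ⟨⟨⟨χ, fun H H' => ?_⟩, fun r H => ?_⟩, Y.2, hY'⟩
  · refine smul_left_injective ℝ hne ?_
    change χ (H + H') • (Y : R.Mat) = (χ H + χ H') • (Y : R.Mat)
    rw [add_smul, ← hY', ← hY', ← hY']
    simp only [ad_apply, Submodule.coe_add, add_mul, mul_add]
    abel
  · refine smul_left_injective ℝ hne ?_
    change χ (r • H) • (Y : R.Mat) = (r • χ H) • (Y : R.Mat)
    rw [smul_assoc, ← hY', ← hY']
    simp [ad_apply, smul_sub]

theorem transpose_mem_rootSpace (hp : 𝔞 ≤ R.pSpace) {α : Module.Dual ℝ 𝔞} {Y : R.Mat}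
    (hY : Y ∈ R.rootSpace 𝔞 α) : Y.transpose ∈ R.rootSpace 𝔞 (-α) := by
  refine ⟨R.transpose_mem_lieAlg hY.1, fun H => ?_⟩
  have hH : (H : R.Mat).transpose = H := (hp H.2).2
  have h := congrArg Matrix.transpose (hY.2 H)
  rw [ad_apply, Matrix.transpose_sub, Matrix.transpose_mul, Matrix.transpose_mul, hH,
    Matrix.transpose_smul] at h
  rw [ad_apply, LinearMap.neg_apply, neg_smul, ← h, neg_sub]

theorem neg_mem_roots (hp : 𝔞 ≤ R.pSpace) {α : Module.Dual ℝ 𝔞} (hα : α ∈ R.roots 𝔞) :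
    -α ∈ R.roots 𝔞 := by
  refine ⟨neg_ne_zero.2 hα.1, ?_⟩
  obtain ⟨Y, hY, hY0⟩ := Submodule.exists_mem_ne_zero_of_ne_bot hα.2
  refine Submodule.ne_bot_iff _ |>.2 ⟨_, R.transpose_mem_rootSpace hp hY, ?_⟩
  simpa using hY0

theorem trace_adLie_eq_zero {H : R.Mat} (hH : H ∈ R.lieAlg) (hHs : H.transpose = H) :
    LinearMap.trace ℝ R.lieAlg (R.adLie hH) = 0 := by
  let θ : R.lieAlg ≃ₗ[ℝ] R.lieAlg := LinearEquiv.ofInvolutive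
    ((Matrix.transposeLinearEquiv (Fin R.n) (Fin R.n) ℝ ℝ).toLinearMap.restrict
      fun _ hY => R.transpose_mem_lieAlg hY) fun Y => Subtype.ext (Matrix.transpose_transpose _)
  have hθ (Y : R.lieAlg) : (θ Y : R.Mat) = (Y : R.Mat).transpose := rfl
  have hθ' (Y : R.lieAlg) : (θ.symm Y : R.Mat) = (Y : R.Mat).transpose := rfl
  have h : θ.conj (R.adLie hH) = (-1 : ℝ) • R.adLie hH := by
    refine LinearMap.ext fun Y => Subtype.ext ?_
    rw [LinearEquiv.conj_apply_apply, hθ, coe_adLie, hθ', LinearMap.smul_apply, Submodule.coe_smul,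
      coe_adLie, neg_one_smul, Matrix.transpose_sub, Matrix.transpose_mul, Matrix.transpose_mul,
      Matrix.transpose_transpose, hHs, neg_sub]
  have h2 := LinearMap.trace_conj' (R.adLie hH) θ
  rw [h, map_smul, smul_eq_mul] at h2
  linarith

section Basis

variable {ι : Type*} [Fintype ι] (b : Module.Basis ι ℝ R.lieAlg) (α : ι → Module.Dual ℝ 𝔞)

theorem repr_eq_zero_of_mem_rootSpace (hb : ∀ i, (b i : R.Mat) ∈ R.rootSpace 𝔞 (α i))
    (hp : 𝔞 ≤ R.pSpace) {β : Module.Dual ℝ 𝔞} {Y : R.lieAlg}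
    (hY : (Y : R.Mat) ∈ R.rootSpace 𝔞 β) {i : ι} (hi : α i ≠ β) : b.repr Y i = 0 := by
  by_contra h0
  refine hi (LinearMap.ext fun H => ?_)
  have h1 : R.adLie (hp H.2).1 Y = β H • Y := Subtype.ext (hY.2 H)
  have h2 : R.adLie (hp H.2).1 Y = ∑ j, (α j H * b.repr Y j) • b j := by
    conv_lhs => rw [← b.sum_repr Y, map_sum]
    refine Finset.sum_congr rfl fun j _ => ?_
    have : R.adLie (hp H.2).1 (b j) = α j H • b j := Subtype.ext ((hb j).2 H)
    rw [map_smul, this, smul_smul, mul_comm]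
  have h3 := congrArg (fun Z => b.repr Z i) (h1.symm.trans h2)
  simp only [map_smul, Finsupp.smul_apply, smul_eq_mul, b.repr_sum_self] at h3
  exact (mul_right_cancel₀ h0 h3).symm

theorem two_mul_rhoN_eq_sum (hb : ∀ i, (b i : R.Mat) ∈ R.rootSpace 𝔞 (α i))
    (hp : 𝔞 ≤ R.pSpace) (X₀ X : 𝔞) [DecidablePred fun i => α i ∈ R.posRoots 𝔞 X₀] :
    2 * R.rhoN 𝔞 X₀ X = ∑ i, if α i ∈ R.posRoots 𝔞 X₀ then α i X else 0 := by
  let P := {i // α i ∈ R.posRoots 𝔞 X₀}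
  let v : P → R.nSpace 𝔞 X₀ := fun i =>
    ⟨b i, Submodule.mem_iSup_of_mem (α i) (Submodule.mem_iSup_of_mem i.2 (hb i))⟩
  have hli : LinearIndependent ℝ v := by
    refine LinearIndependent.of_comp (R.nSpace 𝔞 X₀).subtype ?_
    have := b.linearIndependent.map' R.lieAlg.subtype (Submodule.ker_subtype _)
    exact this.comp (fun i : P => (i : ι)) Subtype.val_injective
  have hsp : ⊤ ≤ Submodule.span ℝ (Set.range v) := by
    have hle : R.nSpace 𝔞 X₀ ≤ (Submodule.span ℝ (Set.range v)).map (R.nSpace 𝔞 X₀).subtype := by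
      refine iSup₂_le fun β hβ Y hY => ?_
      let Y' : R.lieAlg := ⟨Y, hY.1⟩
      have h1 := congrArg (Subtype.val : R.lieAlg → R.Mat) (b.sum_repr Y')
      rw [Submodule.coe_sum] at h1
      change _ = Y at h1
      rw [← h1]
      refine Submodule.sum_mem _ fun i _ => ?_
      by_cases hi : α i = β
      · refine Submodule.smul_mem _ _ ?_
        exact ⟨v ⟨i, hi ▸ hβ⟩, Submodule.subset_span ⟨_, rfl⟩, rfl⟩
      · rw [R.repr_eq_zero_of_mem_rootSpace b α hb hp hY hi, zero_smul]
        exact zero_mem _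
    rintro ⟨Y, hY⟩ -
    obtain ⟨Z, hZ, hZY⟩ := hle hY
    have : Z = ⟨Y, hY⟩ := Subtype.ext hZY
    exact this ▸ hZ
  have htr := LinearMap.trace_eq_sum_of_basis_eigenvectors (Module.Basis.mk hli hsp)
    ((R.ad (X : R.Mat)).restrict (R.ad_mem_nSpace 𝔞 X₀ X)) (fun i => α i X) fun i => by
      rw [Module.Basis.mk_apply]
      exact Subtype.ext ((hb i).2 X)
  rw [rhoN, htr, ← Finset.sum_filter, ← mul_assoc]
  norm_num
  exact (Finset.sum_subtype _ (fun i => by simp) fun i => α i X).symm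

theorem prod_min_exp_eq (hb : ∀ i, (b i : R.Mat) ∈ R.rootSpace 𝔞 (α i))
    (hp : 𝔞 ≤ R.pSpace) {X₀ : 𝔞} (hX₀ : R.IsRegular 𝔞 X₀) {X : 𝔞}
    (hX : X ∈ R.negChamber 𝔞 X₀) :
    ∏ i, min 1 (Real.exp (-α i X)) = Real.exp (2 * R.rhoN 𝔞 X₀ X) := by
  classical
  have h0 : ∑ i, α i X = 0 := by
    rw [← R.trace_adLie_eq_zero (hp X.2).1 (hp X.2).2]
    exact (LinearMap.trace_eq_sum_of_basis_eigenvectors b _ _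
      fun i => Subtype.ext ((hb i).2 X)).symm
  have h1 (i : ι) : min 1 (Real.exp (-α i X)) = Real.exp (min 0 (-α i X)) := by
    rw [Real.exp_monotone.map_min, Real.exp_zero]
  have h2 (i : ι) : min 0 (-α i X) + α i X = if α i ∈ R.posRoots 𝔞 X₀ then α i X else 0 := by
    split_ifs with hi
    · rw [min_eq_left (by linarith [hX _ hi]), zero_add]
    · suffices 0 ≤ α i X by rw [min_eq_right (by linarith)]; ring
      by_cases hα0 : α i = 0
      · simp [hα0]
      have hr : α i ∈ R.roots 𝔞 := by
        refine ⟨hα0, Submodule.ne_bot_iff _ |>.2 ⟨_, hb i, fun h => ?_⟩⟩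
        exact b.ne_zero i (Subtype.ext h)
      have hneg : ¬ 0 < α i X₀ := fun h => hi ⟨hr, h⟩
      have hlt : α i X₀ < 0 := lt_of_le_of_ne (not_lt.1 hneg) (hX₀ _ hr)
      have := hX (-α i) ⟨R.neg_mem_roots hp hr, by simpa using hlt⟩
      simpa using this
  simp_rw [h1]
  rw [← Real.exp_sum, R.two_mul_rhoN_eq_sum b α hb hp X₀ X]
  congr 1
  rw [← Finset.sum_congr rfl fun i _ => h2 i, Finset.sum_add_distrib, h0, add_zero]

end Basis

/-- A basis of the Lie algebra which consists of joint eigenvectors of `ad 𝔞`. -/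
theorem exists_basis_rootVectors (hp : 𝔞 ≤ R.pSpace) (hc : ∀ X ∈ 𝔞, ∀ Y ∈ 𝔞, R.ad X Y = 0) :
    ∃ (ι : Type) (_ : Fintype ι) (b : Module.Basis ι ℝ R.lieAlg) (α : ι → Module.Dual ℝ 𝔞),
      ∀ i, (b i : R.Mat) ∈ R.rootSpace 𝔞 (α i) := by
  obtain ⟨s, hs, hspan, hli⟩ := exists_linearIndependent ℝ
    {Y : R.lieAlg | ∃ α, (Y : R.Mat) ∈ R.rootSpace 𝔞 α}
  rw [R.span_rootSpaces hp hc] at hspan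
  let b : Module.Basis s ℝ R.lieAlg := Module.Basis.mk hli (by rw [Subtype.range_coe, hspan])
  choose α hα using fun i : s => hs i.2
  refine ⟨s, Module.Basis.fintypeIndexOfRankLtAleph0 b ?_, b, α, fun i => ?_⟩
  · exact Module.rank_lt_aleph0 ℝ R.lieAlg
  · rw [Module.Basis.mk_apply]
    exact hα i

end RealReductiveGroup

section Volume

variable {G Y : Type*} [Group G] [MulAction G Y] [MeasurableSpace Y] (μ : Measure Y)
  [SMulInvariantMeasure G Y μ]

open Pointwise in
/-- In a homogeneous space with a nonzero invariant measure the orbits of neighbourhoods of `1`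
have positive volume. -/
theorem volumeWeight_ne_zero [MulAction.IsPretransitive G Y] (hμ : μ ≠ 0) {W : Set G}
    (hW : ∃ c : Set G, c.Countable ∧ ∀ g, ∃ k ∈ c, ∃ w ∈ W, g = k * w) (y : Y) :
    volumeWeight μ W y ≠ 0 := by
  intro h0
  obtain ⟨c, hc, hcov⟩ := hW
  refine hμ (Measure.measure_univ_eq_zero.1 ?_)
  have h1 : μ (⋃ k ∈ c, k • ((fun w => w • y) '' W)) = 0 := by
    refine (measure_biUnion_null_iff hc).2 fun k _ => ?_
    rw [measure_smul]
    exact h0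
  refine measure_mono_null (fun z _ => ?_) h1
  obtain ⟨g, rfl⟩ := MulAction.exists_smul_eq G y z
  obtain ⟨k, hk, w, hw, rfl⟩ := hcov g
  exact Set.mem_iUnion₂.2 ⟨k, hk, w • y, ⟨w, hw, rfl⟩, (mul_smul k w y).symm⟩

/-- Volume weights are bounded below on the orbit of a compact set. -/
theorem exists_pos_le_volumeWeight [TopologicalSpace G] [IsTopologicalGroup G]
    [MulAction.IsPretransitive G Y] (hμ : μ ≠ 0)
    (hG : ∀ W ∈ 𝓝 (1 : G), ∃ c : Set G, c.Countable ∧ ∀ g, ∃ k ∈ c, ∃ w ∈ W, g = k * w)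
    {K : Set G} (hK : K ∈ 𝓝 (1 : G)) {Ω : Set G} (hΩ : IsCompact Ω) (y : Y) :
    ∃ m : ℝ, 0 < m ∧ ∀ g ∈ Ω, ENNReal.ofReal m ≤ volumeWeight μ K (g • y) := by
  obtain ⟨V, hV, hVK⟩ := exists_nhds_split_inv hK
  obtain ⟨t, -, ht⟩ := hΩ.elim_nhds_subcover (fun ω => (fun g => g * ω⁻¹) ⁻¹' V) fun ω _ => by
    refine (continuous_mul_const ω⁻¹).continuousAt.preimage_mem_nhds ?_
    rwa [mul_inv_cancel]
  have hle : ∀ g ∈ Ω, ∃ ω ∈ t, volumeWeight μ V (ω • y) ≤ volumeWeight μ K (g • y) := by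
    intro g hg
    obtain ⟨ω, hω, hgω⟩ := Set.mem_iUnion₂.1 (ht hg)
    refine ⟨ω, hω, measure_mono ?_⟩
    rintro _ ⟨v, hv, rfl⟩
    refine ⟨v / (g * ω⁻¹), hVK v hv _ hgω, ?_⟩
    simp only [smul_smul, div_eq_mul_inv, mul_inv_rev, inv_inv, mul_assoc, inv_mul_cancel, mul_one]
  have hpos : 0 < min 1 (t.inf fun ω => volumeWeight μ V (ω • y)) := by
    refine lt_min zero_lt_one ((Finset.lt_inf_iff ENNReal.zero_lt_top).2 fun ω _ => ?_)
    exact pos_iff_ne_zero.2 (volumeWeight_ne_zero μ hμ (hG V hV) _)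
  have hfin : min 1 (t.inf fun ω => volumeWeight μ V (ω • y)) ≠ ⊤ :=
    ((min_le_left _ _).trans_lt ENNReal.one_lt_top).ne
  refine ⟨_, ENNReal.toReal_pos hpos.ne' hfin, fun g hg => ?_⟩
  rw [ENNReal.ofReal_toReal hfin]
  obtain ⟨ω, hω, h⟩ := hle g hg
  exact (min_le_right _ _).trans ((Finset.inf_le hω).trans h)

open Pointwise in
/-- If `K` is covered by translates of `D` and `D` is conjugated into `F * B` by `a`,
then the volume weight of `K` at `y` is controlled by the one of `B` at `a y`. -/
theorem volumeWeight_le_card_mul {K D B : Set G} (F : Finset G) (s : Finset G) (a : G)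
    (hs : K ⊆ ⋃ k ∈ s, k • D)
    (ha : ∀ x ∈ D, ∃ f ∈ F, ∃ β ∈ B, a * x * a⁻¹ = f * β) (y : Y) :
    volumeWeight μ K y ≤ s.card * (F.card * volumeWeight μ B (a • y)) := by
  have hsub : (fun k => k • y) '' K ⊆
      ⋃ k ∈ s, ⋃ f ∈ F, (k * a⁻¹ * f) • ((fun b => b • a • y) '' B) := by
    rintro _ ⟨κ, hκ, rfl⟩
    obtain ⟨k, hk, x, hx, rfl⟩ := Set.mem_iUnion₂.1 (hs hκ)
    obtain ⟨f, hf, β, hβ, h⟩ := ha x hx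
    refine Set.mem_iUnion₂.2 ⟨k, hk, Set.mem_iUnion₂.2 ⟨f, hf, _, ⟨β, hβ, rfl⟩, ?_⟩⟩
    simp only [smul_smul, smul_eq_mul]
    congr 1
    calc k * a⁻¹ * f * (β * a) = k * a⁻¹ * (f * β) * a := by group
      _ = k * x := by rw [← h]; group
  refine (measure_mono hsub).trans ((measure_biUnion_finset_le _ _).trans ?_)
  rw [← nsmul_eq_mul]
  refine Finset.sum_le_card_nsmul _ _ _ fun k _ => (measure_biUnion_finset_le _ _).trans ?_
  rw [← nsmul_eq_mul]
  refine Finset.sum_le_card_nsmul _ _ _ fun f _ => ?_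
  rw [measure_smul]
  exact le_rfl

end Volume

namespace RealReductiveGroup

variable {G : Type*} [Group G] [TopologicalSpace G] (R : RealReductiveGroup G)

theorem toMat_mul (g h : G) : R.toMat (g * h) = R.toMat g * R.toMat h := by
  simp [toMat]

theorem toMat_one : R.toMat 1 = 1 := by
  simp [toMat]

theorem mul_inv_mem_ker_of_toMat_eq {g h : G} (e : R.toMat g = R.toMat h) :
    g * h⁻¹ ∈ R.proj.ker := by
  rw [MonoidHom.mem_ker, map_mul, map_inv, mul_inv_eq_one]
  exact Subtype.ext (Units.ext e)

theorem exists_mem_ambient_coe_eq (g : G) : ∃ u ∈ R.ambient, (u : R.Mat) = R.toMat g :=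
  ⟨R.proj g, (R.proj g).2, rfl⟩

section
open scoped Matrix.Norms.Operator

theorem isInducing_ambient_coe :
    IsInducing fun u : R.ambient => ((u : GL (Fin R.n) ℝ) : R.Mat) :=
  (Units.isOpenEmbedding_val (R := R.Mat)).isInducing.comp IsInducing.subtypeVal

end

theorem continuous_toMat : Continuous R.toMat :=
  R.isInducing_ambient_coe.continuous.comp R.continuous_proj

/-- Neighbourhoods of `1` in `G` are mapped onto neighbourhoods of `1` in the ambient group. -/
theorem eventually_exists_toMat_eq {B : Set G} (hB : B ∈ 𝓝 (1 : G)) :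
    ∀ᶠ M in 𝓝 (1 : R.Mat), ∀ u ∈ R.ambient, (u : R.Mat) = M → ∃ β ∈ B, R.toMat β = M := by
  have h1 : R.proj '' B ∈ 𝓝 (1 : R.ambient) := by
    have := R.isOpenMap_proj.image_mem_nhds hB
    rwa [map_one] at this
  rw [R.isInducing_ambient_coe.nhds_eq_comap, mem_comap] at h1
  obtain ⟨U, hU, hUB⟩ := h1
  filter_upwards [hU] with M hM u hu huM
  obtain ⟨β, hβ, h⟩ := hUB (show (⟨u, hu⟩ : R.ambient) ∈ _ by simpa [huM] using hM)
  exact ⟨β, hβ, by rw [toMat, h, huM]⟩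

theorem exists_countable_cover (R : RealReductiveGroup G) [IsTopologicalGroup G] {W : Set G}
    (hW : W ∈ 𝓝 (1 : G)) :
    ∃ c : Set G, c.Countable ∧ ∀ g, ∃ k ∈ c, ∃ w ∈ W, g = k * w := by
  have : SecondCountableTopology R.Mat :=
    inferInstanceAs (SecondCountableTopology (Fin R.n → Fin R.n → ℝ))
  have : SecondCountableTopology R.ambient := R.isInducing_ambient_coe.secondCountableTopology
  have hopen (g : G) : IsOpen (R.proj '' ((fun x => g * x) '' interior W)) :=
    R.isOpenMap_proj _ (isOpenMap_mul_left g _ isOpen_interior)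
  obtain ⟨T, hT, hTU⟩ := TopologicalSpace.isOpen_iUnion_countable _ hopen
  have := R.finite_ker
  have hker : (R.proj.ker : Set G).Countable := (Set.toFinite _).countable
  refine ⟨Set.image2 (fun f k => f * k) R.proj.ker T, hker.image2 hT _, fun g => ?_⟩
  have hg : R.proj g ∈ ⋃ i, R.proj '' ((fun x => i * x) '' interior W) :=
    Set.mem_iUnion.2 ⟨g, g, ⟨1, mem_interior_iff_mem_nhds.2 hW, mul_one g⟩, rfl⟩
  rw [← hTU] at hg
  obtain ⟨k, hk, _, ⟨w, hw, rfl⟩, h⟩ := Set.mem_iUnion₂.1 hg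
  refine ⟨_, ⟨g * (k * w)⁻¹, ?_, k, hk, rfl⟩, w, interior_subset hw, by group⟩
  rw [SetLike.mem_coe, MonoidHom.mem_ker, map_mul, map_inv, mul_inv_eq_one]
  exact h.symm

variable {𝔞 : Submodule ℝ R.Mat}

section
open scoped Matrix.Norms.Operator Pointwise

/-- A fixed neighbourhood of `1` in `G` is covered by at most `C / ∏ min(1, e^{-αᵢ(X)})` translates
of a set which is conjugated by `exp X` into a given neighbourhood of `1`, up to the kernel of the
covering `G → ambient`. -/
theorem exists_covering [IsTopologicalGroup G] {ι : Type} [Fintype ι]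
    (b : Module.Basis ι ℝ R.lieAlg) (α : ι → Module.Dual ℝ 𝔞)
    (hb : ∀ i, (b i : R.Mat) ∈ R.rootSpace 𝔞 (α i)) {B : Set G} (hB : B ∈ 𝓝 (1 : G)) :
    ∃ K ∈ 𝓝 (1 : G), ∃ C > (0 : ℝ), ∀ (X : 𝔞) (a : G), R.toMat a = NormedSpace.exp (X : R.Mat) →
      ∃ (s : Finset G) (D : Set G), K ⊆ ⋃ k ∈ s, k • D ∧
        (∀ x ∈ D, ∃ f ∈ R.proj.ker, ∃ β ∈ B, a * x * a⁻¹ = f * β) ∧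
        s.card * ∏ i, min 1 (Real.exp (-α i X)) ≤ C := by
  let L : (ι → ℝ) →ₗ[ℝ] R.Mat := R.lieAlg.subtype ∘ₗ b.equivFun.symm.toLinearMap
  have hLinj : Function.Injective L := Subtype.val_injective.comp b.equivFun.symm.injective
  have hLmem (t : ι → ℝ) : L t ∈ R.lieAlg := (b.equivFun.symm t).2
  have hLapp (t : ι → ℝ) : L t = ∑ i, t i • (b i : R.Mat) := by
    simp only [L, LinearMap.comp_apply, LinearEquiv.coe_coe, Module.Basis.equivFun_symm_apply,
      Submodule.subtype_apply, Submodule.coe_sum, Submodule.coe_smul]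
  have hLc : Continuous L := L.continuous_of_finiteDimensional
  have hexpc : Continuous (NormedSpace.exp : R.Mat → R.Mat) := continuous_exp_real
  have hamb {x : R.Mat} (hx : x ∈ R.lieAlg) :
      ∃ u ∈ R.ambient, (u : R.Mat) = NormedSpace.exp x := by
    simpa using hx 1
  obtain ⟨r, hr, C₁, hC₁, hpack⟩ := exists_packing_bound
    (fun g : G => (R.proj g : GL (Fin R.n) ℝ)) L hLinj (‖(1 : R.Mat)‖₊ + 1)
  obtain ⟨C, hC, hCS⟩ := R.exists_closed_mem_ambient_iff
  have hlie (x : R.Mat) : x ∈ R.lieAlg ↔ ∀ t : ℝ, NormedSpace.exp (t • x) ∈ C := by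
    refine ⟨fun hx t => ?_, fun hx t => ?_⟩
    · obtain ⟨g, hg, h⟩ := hx t
      exact h ▸ (hCS g).1 hg
    · exact ⟨expUnit (t • x), (hCS _).2 (hx t), rfl⟩
  let W : Set R.lieAlg := b.equivFun ⁻¹' Metric.closedBall 0 r
  have hW : W ∈ 𝓝 0 := by
    have hc : Continuous b.equivFun :=
      b.equivFun.toLinearMap.continuous_of_finiteDimensional
    refine hc.continuousAt.preimage_mem_nhds ?_
    rw [map_zero]
    exact Metric.closedBall_mem_nhds _ hr
  have hchart := eventually_mem_exp_image_of_closed_subgroup hC R.ambient hCS R.lieAlg hlie hW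
  have hcont1 : Tendsto (fun z : G × (ι → ℝ) => R.toMat z.1 * NormedSpace.exp (L z.2))
      (𝓝 1 ×ˢ 𝓝 0) (𝓝 1) := by
    have hc : Continuous fun z : G × (ι → ℝ) => R.toMat z.1 * NormedSpace.exp (L z.2) :=
      (R.continuous_toMat.comp continuous_fst).mul (hexpc.comp (hLc.comp continuous_snd))
    have := hc.tendsto (1, 0)
    rwa [nhds_prod_eq, R.toMat_one, map_zero, NormedSpace.exp_zero, mul_one] at this
  have hcont2 : Tendsto (fun z : (ι → ℝ) × (ι → ℝ) =>
      NormedSpace.exp (L z.1) * NormedSpace.exp (-L z.2)) (𝓝 0 ×ˢ 𝓝 0) (𝓝 1) := by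
    have hc : Continuous fun z : (ι → ℝ) × (ι → ℝ) =>
        NormedSpace.exp (L z.1) * NormedSpace.exp (-L z.2) :=
      (hexpc.comp (hLc.comp continuous_fst)).mul (hexpc.comp (hLc.comp continuous_snd).neg)
    have := hc.tendsto (0, 0)
    rwa [nhds_prod_eq, map_zero, neg_zero, NormedSpace.exp_zero, mul_one] at this
  obtain ⟨p₁, hp₁, q₁, hq₁, h₁⟩ := eventually_prod_iff.1 (hcont1.eventually hchart)
  obtain ⟨V, hV, h₂⟩ := eventually_prod_self_iff'.1
    (hcont2.eventually (R.eventually_exists_toMat_eq hB))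
  have hnorm : ∀ᶠ g in 𝓝 (1 : G), ‖R.toMat g⁻¹‖ < ‖(1 : R.Mat)‖ + 1 := by
    have hc : Continuous fun g : G => ‖R.toMat g⁻¹‖ :=
      (R.continuous_toMat.comp continuous_inv).norm
    refine hc.continuousAt.eventually_lt_const ?_
    simp only [inv_one, R.toMat_one]
    exact lt_add_one _
  obtain ⟨ε, hε, hεV⟩ := Metric.nhds_basis_closedBall.mem_iff.1
    (inter_mem (inter_mem hV hq₁) (Metric.closedBall_mem_nhds (0 : ι → ℝ) hr))
  have hεr : ∀ t : ι → ℝ, (∀ i, |t i| ≤ ε) → t ∈ Metric.closedBall (0 : ι → ℝ) ε := by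
    intro t ht
    rw [mem_closedBall_zero_iff, pi_norm_le_iff_of_nonneg hε.le]
    exact ht
  set ε' := min ε r with hε'def
  have hε' : 0 < ε' := lt_min hε hr
  refine ⟨{g | p₁ g} ∩ {g | ‖R.toMat g⁻¹‖ < ‖(1 : R.Mat)‖ + 1}, inter_mem hp₁ hnorm,
    C₁ / ε' ^ Fintype.card ι, by positivity, fun X a ha => ?_⟩
  let w : ι → ℝ := fun i => min 1 (Real.exp (-α i X))
  have hw0 (i : ι) : 0 < w i := lt_min one_pos (Real.exp_pos _)
  let η : ι → ℝ := fun i => ε' * w i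
  have hη0 (i : ι) : 0 ≤ η i := (mul_pos hε' (hw0 i)).le
  have hηle (i : ι) : η i ≤ ε' := mul_le_of_le_one_right hε'.le (min_le_left _ _)
  have hηprod : ∏ i, η i = ε' ^ Fintype.card ι * ∏ i, w i := by
    rw [Finset.prod_mul_distrib, Finset.prod_const, Finset.card_univ]
  have hηpos : 0 < ∏ i, η i := Finset.prod_pos fun i _ => mul_pos hε' (hw0 i)
  have habs {t : ι → ℝ} (ht : t ∈ Set.Icc (-η) η) (i : ι) : |t i| ≤ η i :=
    abs_le.2 ⟨ht.1 i, ht.2 i⟩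
  have hbox {t : ι → ℝ} (ht : t ∈ Set.Icc (-η) η) : t ∈ Metric.closedBall (0 : ι → ℝ) ε :=
    hεr t fun i => (habs ht i).trans ((hηle i).trans (min_le_left _ _))
  have h0box : (0 : ι → ℝ) ∈ Set.Icc (-η) η :=
    ⟨fun i => by simpa using hη0 i, fun i => hη0 i⟩
  have h0ball : (0 : ι → ℝ) ∈ V := (hεV (Metric.mem_closedBall_self hε.le)).1.1
  let D : Set G := {g | ∃ t ∈ Set.Icc (-η) η, R.toMat g = NormedSpace.exp (L t)}
  have hD1 : D.Nonempty := ⟨1, 0, h0box, by rw [R.toMat_one, map_zero, NormedSpace.exp_zero]⟩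
  have hbound : ∀ s : Finset G,
      (s : Set G) ⊆ {g | p₁ g} ∩ {g | ‖R.toMat g⁻¹‖ < ‖(1 : R.Mat)‖ + 1} →
      ((s : Set G).PairwiseDisjoint fun k => k • D) →
      s.card * ∏ i, η i ≤ C₁ := by
    intro s hsK hsD
    refine hpack η hη0 (fun i => (hηle i).trans (min_le_right _ _)) s (fun k hk => ?_) ?_ ?_
    · have h1 : ‖R.toMat k⁻¹‖ ≤ ‖(1 : R.Mat)‖ + 1 := le_of_lt (hsK hk).2
      have h2 : R.toMat k⁻¹ = (((R.proj k : GL (Fin R.n) ℝ)⁻¹ : GL (Fin R.n) ℝ) : R.Mat) := by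
        rw [toMat, map_inv, Subgroup.coe_inv]
      rw [← h2]
      simpa using h1
    · intro k hk k' hk' hne
      refine Set.disjoint_left.2 ?_
      rintro _ ⟨t, ht, rfl⟩ ⟨t', ht', h⟩
      obtain ⟨u, hu, hut⟩ := hamb (hLmem t)
      obtain ⟨g, -, hg⟩ := h₂ t (hεV (hbox ht)).1.1 0 h0ball u hu (by
        rw [map_zero, neg_zero, NormedSpace.exp_zero, mul_one]; exact hut)
      rw [map_zero, neg_zero, NormedSpace.exp_zero, mul_one] at hg
      refine Set.disjoint_left.1 (hsD hk hk' hne) ⟨g, ⟨t, ht, hg⟩, rfl⟩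
        ⟨k'⁻¹ * (k * g), ⟨t', ht', ?_⟩, mul_inv_cancel_left _ _⟩
      have h3 : R.toMat (k * g) = R.toMat k' * NormedSpace.exp (L t') := by
        rw [R.toMat_mul, hg]
        exact h.symm
      rw [R.toMat_mul, h3, ← mul_assoc, ← R.toMat_mul, inv_mul_cancel, R.toMat_one, one_mul]
    · intro k hk t ht
      have hmem : R.toMat k * NormedSpace.exp (L t) ∈ C := by
        obtain ⟨u, hu, hut⟩ := hamb (hLmem t)
        obtain ⟨v, hv, hvk⟩ := R.exists_mem_ambient_coe_eq k
        rw [← hut, ← hvk, ← Units.val_mul]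
        exact (hCS _).1 (mul_mem hv hu)
      obtain ⟨x, hxW, hx⟩ := h₁ (hsK hk).1 (hεV (hbox ht)).1.2 hmem
      refine ⟨b.equivFun x, hxW, hx.trans ?_⟩
      simp [L]
  obtain ⟨s, hsK, hsD, hsc⟩ := exists_covering_of_packing_bound _ D hD1 ⌊C₁ / ∏ i, η i⌋₊
    fun s hsK hsD => Nat.le_floor ((le_div_iff₀ hηpos).2 (hbound s hsK hsD))
  refine ⟨s, _, hsc, ?_, ?_⟩
  · rintro _ ⟨d, ⟨t, ht, hdt⟩, e, ⟨t', ht', het⟩, rfl⟩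
    have hainv : R.toMat a⁻¹ = NormedSpace.exp (-(X : R.Mat)) := by
      have h1 : (R.proj a : GL (Fin R.n) ℝ) = expUnit (X : R.Mat) := Units.ext ha
      rw [toMat, map_inv, Subgroup.coe_inv, h1]
      rfl
    let T : (ι → ℝ) → (ι → ℝ) := fun t i => Real.exp (α i X) * t i
    have hconj (t : ι → ℝ) :
        R.toMat a * L t * R.toMat a⁻¹ = L (T t) := by
      rw [hLapp, hLapp, Finset.mul_sum, Finset.sum_mul]
      refine Finset.sum_congr rfl fun i _ => ?_
      have h1 := exp_mul_mul_exp_neg_of_commutator_eq_smul ((hb i).2 X)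
      have h2 : R.toMat a * (b i : R.Mat) * R.toMat a⁻¹ = Real.exp (α i X) • (b i : R.Mat) := by
        rw [ha, hainv]
        exact h1
      rw [mul_smul_comm, smul_mul_assoc, h2, smul_smul, mul_comm]
    have hTball {t : ι → ℝ} (ht : t ∈ Set.Icc (-η) η) : T t ∈ V := by
      refine (hεV (hεr _ fun i => ?_)).1.1
      rw [abs_mul, abs_of_pos (Real.exp_pos _)]
      calc Real.exp (α i X) * |t i| ≤ Real.exp (α i X) * (ε' * Real.exp (-α i X)) := by
            refine mul_le_mul_of_nonneg_left ((habs ht i).trans ?_) (Real.exp_pos _).le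
            exact mul_le_mul_of_nonneg_left (min_le_right _ _) hε'.le
        _ = ε' := by rw [mul_left_comm, ← Real.exp_add, add_neg_cancel, Real.exp_zero, mul_one]
        _ ≤ ε := min_le_left _ _
    have hexpconj (x : R.Mat) : R.toMat a * NormedSpace.exp x * R.toMat a⁻¹ =
        NormedSpace.exp (R.toMat a * x * R.toMat a⁻¹) := by
      have := Matrix.exp_units_conj (R.proj a : GL (Fin R.n) ℝ) x
      have h2 : R.toMat a⁻¹ = (((R.proj a : GL (Fin R.n) ℝ)⁻¹ : GL (Fin R.n) ℝ) : R.Mat) := by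
        rw [toMat, map_inv, Subgroup.coe_inv]
      rw [h2]
      exact this.symm
    have hmul : R.toMat a⁻¹ * R.toMat a = 1 := by
      rw [← R.toMat_mul, inv_mul_cancel, R.toMat_one]
    have he : R.toMat e = NormedSpace.exp (-L t') := by
      have h1 : R.toMat e⁻¹ * NormedSpace.exp (-L t') = 1 := by
        rw [het]; exact (expUnit (L t')).mul_inv
      calc R.toMat e = R.toMat e * (R.toMat e⁻¹ * NormedSpace.exp (-L t')) := by rw [h1, mul_one]
        _ = NormedSpace.exp (-L t') := by
          rw [← mul_assoc, ← R.toMat_mul, mul_inv_cancel, R.toMat_one, one_mul]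
    have hfin : R.toMat (a * (d * e) * a⁻¹) =
        NormedSpace.exp (L (T t)) * NormedSpace.exp (-L (T t')) := by
      rw [← hconj, ← hconj, ← neg_mul, ← mul_neg, ← hexpconj, ← hexpconj, ← he, ← hdt]
      simp only [← R.toMat_mul]
      congr 1
      group
    obtain ⟨u, hu, hut⟩ := R.exists_mem_ambient_coe_eq (a * (d * e) * a⁻¹)
    obtain ⟨β, hβ, h⟩ := h₂ _ (hTball ht) _ (hTball ht') u hu (hut.trans hfin)
    exact ⟨_, R.mul_inv_mem_ker_of_toMat_eq (hfin.trans h.symm), β, hβ,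
      (inv_mul_cancel_right _ _).symm⟩
  · rw [le_div_iff₀ (by positivity), mul_assoc, mul_comm (∏ i, _), ← hηprod]
    exact hbound s hsK hsD

end

end RealReductiveGroup

theorem mainTheorem12 {G : Type*} [Group G] [TopologicalSpace G] [IsTopologicalGroup G]
    [T2Space G] (R : RealReductiveGroup G)
    (𝔞 : Submodule ℝ R.Mat) (h𝔞 : R.IsMaximalAbelian 𝔞)
    (X₀ : 𝔞) (hX₀ : R.IsRegular 𝔞 X₀)
    (Γ : Subgroup G) [MeasurableSpace (G ⧸ Γ)] [BorelSpace (G ⧸ Γ)]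
    (hΓ : IsLatticeSubgroup Γ)
    (volY : Measure (G ⧸ Γ)) [SMulInvariantMeasure G (G ⧸ Γ) volY] [IsFiniteMeasure volY]
    (hvol : volY ≠ 0)
    (B : Set G) (hB : B ∈ 𝓝 (1 : G)) (Ω : Set G) (hΩ : IsCompact Ω) :
    ∃ C : ℝ, 0 < C ∧ ∀ X ∈ R.negChamber 𝔞 X₀, ∀ a : G, R.IsExp (X : R.Mat) a →
      ENNReal.ofReal (C * Real.exp (2 * R.rhoN 𝔞 X₀ X)) ≤
        ⨅ g ∈ Ω, volumeWeight volY B ((a * g) • ((1 : G) : G ⧸ Γ)) := by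
  have hp : 𝔞 ≤ R.pSpace := h𝔞.prop.1
  obtain ⟨ι, _, b, α, hb⟩ := R.exists_basis_rootVectors hp h𝔞.prop.2
  obtain ⟨K, hK, C₁, hC₁, hcov⟩ := R.exists_covering b α hb hB
  have hms : MeasurableConstSMul G (G ⧸ Γ) := ⟨fun g => (continuous_const_smul g).measurable⟩
  obtain ⟨m, hm, hmΩ⟩ := exists_pos_le_volumeWeight volY hvol
    (fun W hW => R.exists_countable_cover hW) hK hΩ ((1 : G) : G ⧸ Γ)
  have := R.finite_ker
  let F : Finset G := (Set.toFinite (R.proj.ker : Set G)).toFinset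
  have hF : (0 : ℝ) < F.card := by
    rw [Nat.cast_pos, Finset.card_pos]
    exact ⟨1, by simp [F]⟩
  refine ⟨m / (C₁ * F.card), by positivity, fun X hX a ha => le_iInf₂ fun g hg => ?_⟩
  obtain ⟨φ, -, hφ, rfl⟩ := ha
  obtain ⟨s, D, hsD, hD, hsC⟩ := hcov X _ (by rw [hφ 1, one_smul])
  have hE : ∏ i, min 1 (Real.exp (-α i X)) = Real.exp (2 * R.rhoN 𝔞 X₀ X) :=
    R.prod_min_exp_eq b α hb hp hX₀ hX
  rw [hE] at hsC
  set a := φ (Multiplicative.ofAdd 1)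
  set E := Real.exp (2 * R.rhoN 𝔞 X₀ X)
  have hvol := (hmΩ g hg).trans (volumeWeight_le_card_mul volY F s a hsD
    (fun x hx => by simpa [F] using hD x hx) (g • ((1 : G) : G ⧸ Γ)))
  rw [smul_smul] at hvol
  set v := volumeWeight volY B ((a * g) • ((1 : G) : G ⧸ Γ))
  have hv : v ≠ ⊤ := measure_ne_top _ _
  rw [← ENNReal.ofReal_toReal hv, ← ENNReal.ofReal_natCast, ← ENNReal.ofReal_natCast,
    ← ENNReal.ofReal_mul (Nat.cast_nonneg _), ← ENNReal.ofReal_mul (Nat.cast_nonneg _),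
    ENNReal.ofReal_le_ofReal_iff (by positivity)] at hvol
  rw [← ENNReal.ofReal_toReal hv]
  refine ENNReal.ofReal_le_ofReal ?_
  rw [div_mul_eq_mul_div, div_le_iff₀ (by positivity)]
  calc m * E ≤ s.card * (F.card * v.toReal) * E :=
        mul_le_mul_of_nonneg_right hvol (Real.exp_pos _).le
    _ = s.card * E * (F.card * v.toReal) := by ring
    _ ≤ C₁ * (F.card * v.toReal) := mul_le_mul_of_nonneg_right hsC (by positivity)
    _ = v.toReal * (C₁ * F.card) := by ring
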